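/- Let $K\subset L$ be a central extension of division rings, i.e. $L$ is a division ring and $K$ is a subfield of the center of $L$. Let $n\ge 1$ and let $A$ be an $n$-dimensional $K$-subspace of $L$. Suppose that $A$ contains no set of the form $lM=\{lm : m\in M\}$ or $Ml=\{ml : m\in M\}$, where $l\in L$ is nonzero and $M$ is a sub-division ring of $L$ with $K\subsetneq M\subseteq L$ that is finite-dimensional over $K$. Then for every $n$-dimensional $K$-subspace $B$ of $L$ with $1\notin B$, the subspace $A$ is matched to $B$ in the sense of Eliahou and Lecouvey: for every ordered basis $(a_1,\dots,a_n)$ of $A$ over $K$ there is an ordered basis $(b_1,\dots,b_n)$ of $B$ over $K$ such that $$a_i^{-1}A\cap B\subseteq \langle b_j : 1\le j\le n,\ j\ne i\rangle\qquad\text{for all } 1\le i\le n,$$ where $a_i^{-1}A=\{a_i^{-1}x : x\in A\}$ and $\langle\,\cdot\,\rangle$ denotes the $K$-linear span. -/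

import Mathlib

/- Throughout, `K` is a field, `L` a division ring and `[Algebra K L]` makes `K` a subfield of the
center of `L`: this is a central extension `K ⊂ L` of division rings. -/

/-- A `K`-subalgebra `M` of a division ring `L` is a sub-division ring of `L` (containing `K`)
if it is closed under inverses. -/
def IsSubDivisionRing {K L : Type*} [Field K] [DivisionRing L] [Algebra K L]
    (M : Subalgebra K L) : Prop :=
  ∀ x ∈ M, x⁻¹ ∈ M

/-- The `K`-subspace `l V = {l v | v ∈ V}` of `L`. -/
def leftTranslate {K L : Type*} [Field K] [DivisionRing L] [Algebra K L]
    (l : L) (V : Submodule K L) : Submodule K L :=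
  V.map (LinearMap.mulLeft K l)

/-- The `K`-subspace `V l = {v l | v ∈ V}` of `L`. -/
def rightTranslate {K L : Type*} [Field K] [DivisionRing L] [Algebra K L]
    (l : L) (V : Submodule K L) : Submodule K L :=
  V.map (LinearMap.mulRight K l)

/-- `A` contains a left or right linear translate `l M` or `M l`, `l ≠ 0`, of some sub-division
ring `K ⊂ M ⊂ L` which is finite-dimensional over `K` and nontrivial, i.e. different from `K`
(`⊥ : Subalgebra K L` is the image of `K` in `L`). -/
def ContainsNontrivialTranslate {K L : Type*} [Field K] [DivisionRing L] [Algebra K L]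
    (A : Submodule K L) : Prop :=
  ∃ M : Subalgebra K L, IsSubDivisionRing M ∧ FiniteDimensional K M ∧ M ≠ ⊥ ∧
    ∃ l : L, l ≠ 0 ∧
      (leftTranslate l (Subalgebra.toSubmodule M) ≤ A ∨
        rightTranslate l (Subalgebra.toSubmodule M) ≤ A)

/-- The ordered basis `a` of `A` is matched to the ordered basis `b` of `B`: for every `i`,
`aᵢ⁻¹ A ∩ B` is contained in the span of the `bⱼ` with `j ≠ i`. -/
def BasisMatched {K L : Type*} [Field K] [DivisionRing L] [Algebra K L]
    {n : ℕ} {A B : Submodule K L}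
    (a : Module.Basis (Fin n) K A) (b : Module.Basis (Fin n) K B) : Prop :=
  ∀ i : Fin n, leftTranslate ((a i : L)⁻¹) A ⊓ B ≤
    Submodule.span K ((fun j => (b j : L)) '' {j | j ≠ i})

/-- The `n`-dimensional subspace `A` is matched to the `n`-dimensional subspace `B`: every ordered
basis of `A` can be matched to an ordered basis of `B`. -/
def SubspaceMatched {K L : Type*} [Field K] [DivisionRing L] [Algebra K L]
    (n : ℕ) (A B : Submodule K L) : Prop :=
  ∀ a : Module.Basis (Fin n) K A, ∃ b : Module.Basis (Fin n) K B, BasisMatched a b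

/-! Put `U i` = `a_i⁻¹A ∩ B`. The required basis of `B` is dual to a family of independent
functionals, the `i`-th vanishing on `U i`. By Rado's theorem it exists as soon as dim ⋂_{i∈J} `U i`
+ |J| ≤ n for every J. If a nonempty J violates this, let S be the span of the `a i`, i ∈ J, and W
the intersection. Then S(W + K) ⊆ A, and since 1 ∉ B the two factors have total dimension at least n
+ 2.

`IsProductPair.containsNontrivialTranslate` rules this out. Among pairs with product inside A, take
one of maximal total dimension, then with smallest smaller factor. The transforms (S ∩ Sg, T + g⁻¹T)
and (S + Sg, T ∩ g⁻¹T) force that factor to be stable under division by any g carrying one of its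
nonzero elements back into it. It is therefore a translate of a division ring, of dimension at least
2. -/

open Module

/-! ### Independent transversals and their dual form -/

section Rado

variable {K V ι : Type*} [Field K] [AddCommGroup V] [Module K V]

/-- A proper decomposition of a subspace of dimension at least two. -/
theorem exists_lt_lt_sup_eq_of_two_le_finrank (E : Submodule K V) (h : 2 ≤ finrank K E) :
    ∃ H H' : Submodule K V, H < E ∧ H' < E ∧ H ⊔ H' = E := by
  have hne : E ≠ ⊥ := by
    rintro rfl
    simp at h
  obtain ⟨x, hx, hx0⟩ := E.ne_bot_iff.1 hne
  obtain ⟨Q, hQ⟩ := exists_isCompl (K ∙ x)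
  have hxE : K ∙ x ≤ E := by simpa using hx
  refine ⟨K ∙ x, Q ⊓ E, lt_of_le_of_ne hxE ?_, lt_of_le_of_ne inf_le_right ?_, ?_⟩
  · intro he
    rw [← he, finrank_span_singleton hx0] at h
    omega
  · intro he
    have : x ∈ (K ∙ x) ⊓ Q := ⟨Submodule.mem_span_singleton_self x, inf_eq_right.1 he hx⟩
    rw [hQ.inf_eq_bot] at this
    exact hx0 this
  · rw [← sup_inf_assoc_of_le Q hxE, hQ.sup_eq_top, top_inf_eq]

variable [FiniteDimensional K V]

/-- Rado's theorem on independent transversals, for a finite family of subspaces. -/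
theorem exists_linearIndependent_mem_of_card_le_finrank_sup [Fintype ι] [DecidableEq ι]
    (E : ι → Submodule K V) (h : ∀ J : Finset ι, J.card ≤ finrank K (J.sup E : Submodule K V)) :
    ∃ v : ι → V, LinearIndependent K v ∧ ∀ i, v i ∈ E i := by
  -- Shrink the family to minimal total dimension while keeping Rado's condition; the aim is that
  -- every member becomes a line.
  obtain ⟨F, ⟨hFE, hF⟩, hmin⟩ := (measure fun F : ι → Submodule K V =>
    ∑ i, finrank K (F i)).wf.has_min
    {F | F ≤ E ∧ ∀ J : Finset ι, J.card ≤ finrank K (J.sup F : Submodule K V)} ⟨E, le_rfl, h⟩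
  -- By minimality, replacing `F i` by `H` breaks the condition at some set, which must contain `i`;
  -- erase `i` from it.
  have key : ∀ i, ∀ H < F i, ∃ J : Finset ι, i ∉ J ∧
      finrank K (H ⊔ J.sup F : Submodule K V) ≤ J.card := by
    intro i H hH
    have hlt : ∑ j, finrank K (Function.update F i H j) < ∑ j, finrank K (F j) := by
      refine Finset.sum_lt_sum (fun j _ => ?_) ⟨i, Finset.mem_univ i, ?_⟩
      · by_cases hj : j = i
        · subst hj
          rw [Function.update_self]
          exact Submodule.finrank_mono hH.le
        · rw [Function.update_of_ne hj]
      · rw [Function.update_self]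
        exact Submodule.finrank_lt_finrank_of_lt hH
    have hnot : ¬ ∀ J : Finset ι,
        J.card ≤ finrank K (J.sup (Function.update F i H) : Submodule K V) := by
      intro hall
      refine hmin (Function.update F i H) ⟨fun j => ?_, hall⟩ hlt
      by_cases hj : j = i
      · subst hj
        simpa using hH.le.trans (hFE j)
      · simpa [hj] using hFE j
    push Not at hnot
    obtain ⟨J, hJ⟩ := hnot
    have hcongr : ∀ J' : Finset ι, i ∉ J' → J'.sup (Function.update F i H) = J'.sup F := by
      intro J' hi
      refine Finset.sup_congr rfl fun j hj => ?_
      rw [Function.update_of_ne]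
      rintro rfl
      exact hi hj
    by_cases hi : i ∈ J
    · refine ⟨J.erase i, J.notMem_erase i, ?_⟩
      rw [← Finset.insert_erase hi, Finset.sup_insert, Function.update_self,
        hcongr _ (J.notMem_erase i), Finset.card_insert_of_notMem (J.notMem_erase i)] at hJ
      omega
    · rw [hcongr J hi] at hJ
      exact absurd (hF J) (by omega)
  have hone : ∀ i, finrank K (F i) = 1 := by
    intro i
    have h1 : 1 ≤ finrank K (F i) := by simpa using hF {i}
    by_contra hne
    obtain ⟨H, H', hH, hH', hsup⟩ :=
      exists_lt_lt_sup_eq_of_two_le_finrank (F i) (by omega)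
    obtain ⟨J, hiJ, hJ⟩ := key i H hH
    obtain ⟨J', hiJ', hJ'⟩ := key i H' hH'
    -- Submodularity: the sum has dimension at least |J ∪ J'| + 1 and the intersection at least |J ∩
    -- J'|, exceeding the bound |J| + |J'|.
    have hU := hF (insert i (J ∪ J'))
    have hI := hF (J ∩ J')
    have hmod := Submodule.finrank_sup_add_finrank_inf_eq (H ⊔ J.sup F) (H' ⊔ J'.sup F)
    rw [Finset.card_insert_of_notMem (by simp [hiJ, hiJ']), Finset.sup_insert, Finset.sup_union,
      ← hsup, sup_sup_sup_comm] at hU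
    have hle : (J ∩ J').sup F ≤ (H ⊔ J.sup F) ⊓ (H' ⊔ J'.sup F) :=
      le_inf ((Finset.sup_mono Finset.inter_subset_left).trans le_sup_right)
        ((Finset.sup_mono Finset.inter_subset_right).trans le_sup_right)
    have := Submodule.finrank_mono hle
    have := Finset.card_union_add_card_inter J J'
    omega
  have hspan : ∀ i, ∃ v, F i = K ∙ v := by
    intro i
    obtain ⟨v, hv⟩ := finrank_le_one_iff.1 (hone i).le
    refine ⟨v, le_antisymm (fun x hx => ?_) (by simp)⟩
    obtain ⟨c, hc⟩ := hv ⟨x, hx⟩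
    exact Submodule.mem_span_singleton.2 ⟨c, congrArg Subtype.val hc⟩
  choose v hv using hspan
  refine ⟨v, linearIndependent_iff_card_le_finrank_span.2 ?_, fun i => hFE i ?_⟩
  · have hs : Submodule.span K (Set.range v) = Finset.univ.sup F := by
      rw [Submodule.span_range_eq_iSup, Finset.sup_univ_eq_iSup]
      exact iSup_congr fun i => (hv i).symm
    rw [Set.finrank, hs]
    exact hF Finset.univ
  · rw [hv i]
    exact Submodule.mem_span_singleton_self _

/-- The dual form of Rado's theorem: subspaces whose intersections are small enough avoid the
successive vectors of some basis. -/
theorem exists_basis_le_span_of_finrank_inf_add_card_le [Fintype ι] [DecidableEq ι]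
    (hcard : Fintype.card ι = finrank K V) (U : ι → Submodule K V)
    (h : ∀ J : Finset ι, finrank K (J.inf U : Submodule K V) + J.card ≤ finrank K V) :
    ∃ b : Basis ι K V, ∀ i, U i ≤ Submodule.span K (b '' {j | j ≠ i}) := by
  obtain ⟨φ, hφ, hmem⟩ := exists_linearIndependent_mem_of_card_le_finrank_sup
    (fun i => (U i).dualAnnihilator) (fun J => by
      have hsup : J.sup (fun i => (U i).dualAnnihilator) = (J.inf U).dualAnnihilator := by
        induction J using Finset.induction_on with
        | empty => simp
        | insert a s _ ih =>
          rw [Finset.sup_insert, Finset.inf_insert, ih, Subspace.dualAnnihilator_inf_eq]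
      have := Subspace.finrank_add_finrank_dualAnnihilator_eq (J.inf U)
      have := h J
      rw [hsup]
      omega)
  let ψ : Basis ι K (Dual K V) :=
    basisOfLinearIndependentOfCardEqFinrank' φ hφ (by rw [hcard, Subspace.dual_finrank_eq])
  let b : Basis ι K V := ψ.dualBasis.map (evalEquiv K V).symm
  have hb : ∀ i j, φ i (b j) = if j = i then 1 else 0 := by
    intro i j
    have h1 : evalEquiv K V (b j) = ψ.dualBasis j := by simp [b]
    have h2 : φ i = ψ i := by simp [ψ]
    calc φ i (b j) = evalEquiv K V (b j) (φ i) := rfl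
      _ = _ := by rw [h1, h2, Basis.dualBasis_apply_self]; simp [eq_comm]
  refine ⟨b, fun i x hx => ?_⟩
  have hrepr : b.repr x i = 0 := by
    have h0 : φ i x = 0 := (Submodule.mem_dualAnnihilator _).1 (hmem i) x hx
    rw [← b.sum_repr x, map_sum] at h0
    simpa [hb] using h0
  rw [b.mem_span_image]
  intro j hj
  rintro rfl
  exact (Finsupp.mem_support_iff.1 hj) hrepr

end Rado

/-! ### Translates and recognition of sub-division rings -/

section Translates

variable {K L : Type*} [Field K] [DivisionRing L] [Algebra K L]

theorem mem_leftTranslate {l : L} (hl : l ≠ 0) {V : Submodule K L} {x : L} :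
    x ∈ leftTranslate l V ↔ l⁻¹ * x ∈ V := by
  constructor
  · rintro ⟨v, hv, rfl⟩
    simpa [hl] using hv
  · exact fun h => ⟨_, h, by simp [hl]⟩

theorem mem_rightTranslate {l : L} (hl : l ≠ 0) {V : Submodule K L} {x : L} :
    x ∈ rightTranslate l V ↔ x * l⁻¹ ∈ V := by
  constructor
  · rintro ⟨v, hv, rfl⟩
    simpa [hl] using hv
  · exact fun h => ⟨_, h, by simp [hl]⟩

/-- Left translation by a nonzero element as a linear equivalence. -/
noncomputable def leftTranslateEquiv {l : L} (hl : l ≠ 0) (V : Submodule K L) :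
    V ≃ₗ[K] leftTranslate l V :=
  Submodule.equivMapOfInjective _ (mul_right_injective₀ hl) V

/-- Right translation by a nonzero element as a linear equivalence. -/
noncomputable def rightTranslateEquiv {l : L} (hl : l ≠ 0) (V : Submodule K L) :
    V ≃ₗ[K] rightTranslate l V :=
  Submodule.equivMapOfInjective _ (mul_left_injective₀ hl) V

instance finiteDimensional_leftTranslate (l : L) (V : Submodule K L) [FiniteDimensional K V] :
    FiniteDimensional K (leftTranslate l V) :=
  inferInstanceAs (FiniteDimensional K (V.map (LinearMap.mulLeft K l)))

instance finiteDimensional_rightTranslate (l : L) (V : Submodule K L) [FiniteDimensional K V] :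
    FiniteDimensional K (rightTranslate l V) :=
  inferInstanceAs (FiniteDimensional K (V.map (LinearMap.mulRight K l)))

/-- A subspace stable under right division by its return elements is a left translate of a
sub-division ring. -/
theorem exists_leftTranslate_eq_of_mul_inv_mem {A : Submodule K L} (hA : A ≠ ⊥)
    (h : ∀ g : L, g ≠ 0 → ∀ x ∈ A, x ≠ 0 → x * g ∈ A → ∀ y ∈ A, y * g⁻¹ ∈ A) :
    ∃ M : Subalgebra K L, IsSubDivisionRing M ∧
      ∃ l : L, l ≠ 0 ∧ leftTranslate l (Subalgebra.toSubmodule M) = A := by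
  obtain ⟨a, ha, ha0⟩ := A.ne_bot_iff.1 hA
  -- The candidate ring is `a⁻¹A`: it contains 1 and is closed under `x * g⁻¹`, hence under inverses
  -- and products.
  have hdiv : ∀ x g : L, a * x ∈ A → a * g ∈ A → a * (x * g⁻¹) ∈ A := by
    intro x g hx hg
    rcases eq_or_ne g 0 with rfl | hg0
    · simp
    · rw [← mul_assoc]
      exact h g hg0 a ha ha0 hg _ hx
  have hinv : ∀ g : L, a * g ∈ A → a * g⁻¹ ∈ A := fun g hg => by
    simpa using hdiv 1 g (by simpa using ha) hg
  let M : Subalgebra K L :=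
    { carrier := {x | a * x ∈ A}
      mul_mem' := fun {x y} hx hy => by simpa using hdiv x y⁻¹ hx (hinv y hy)
      add_mem' := fun {x y} hx hy => by
        simpa [mul_add] using A.add_mem hx hy
      algebraMap_mem' := fun r => by
        change a * algebraMap K L r ∈ A
        rw [← Algebra.commutes, ← Algebra.smul_def]
        exact A.smul_mem r ha }
  refine ⟨M, hinv, a, ha0, Submodule.ext fun x => ?_⟩
  rw [mem_leftTranslate ha0]
  change a * (a⁻¹ * x) ∈ A ↔ _
  rw [mul_inv_cancel_left₀ ha0]

/-- A subspace stable under left division by its return elements is a right translate of a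
sub-division ring. -/
theorem exists_rightTranslate_eq_of_inv_mul_mem {A : Submodule K L} (hA : A ≠ ⊥)
    (h : ∀ g : L, g ≠ 0 → ∀ x ∈ A, x ≠ 0 → g * x ∈ A → ∀ y ∈ A, g⁻¹ * y ∈ A) :
    ∃ M : Subalgebra K L, IsSubDivisionRing M ∧
      ∃ l : L, l ≠ 0 ∧ rightTranslate l (Subalgebra.toSubmodule M) = A := by
  obtain ⟨a, ha, ha0⟩ := A.ne_bot_iff.1 hA
  have hdiv : ∀ x g : L, x * a ∈ A → g * a ∈ A → (g⁻¹ * x) * a ∈ A := by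
    intro x g hx hg
    rcases eq_or_ne g 0 with rfl | hg0
    · simp
    · rw [mul_assoc]
      exact h g hg0 a ha ha0 hg _ hx
  have hinv : ∀ g : L, g * a ∈ A → g⁻¹ * a ∈ A := fun g hg => by
    simpa using hdiv 1 g (by simpa using ha) hg
  let M : Subalgebra K L :=
    { carrier := {x | x * a ∈ A}
      mul_mem' := fun {x y} hx hy => by simpa using hdiv y x⁻¹ hy (hinv x hx)
      add_mem' := fun {x y} hx hy => by
        simpa [add_mul] using A.add_mem hx hy
      algebraMap_mem' := fun r => by
        change algebraMap K L r * a ∈ A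
        rw [← Algebra.smul_def]
        exact A.smul_mem r ha }
  refine ⟨M, hinv, a, ha0, Submodule.ext fun x => ?_⟩
  rw [mem_rightTranslate ha0]
  change x * a⁻¹ * a ∈ A ↔ _
  rw [inv_mul_cancel_right₀ ha0]

end Translates

/-! ### Product pairs and the Kemperman-type theorem -/

section Product

variable {K L : Type*} [Field K] [DivisionRing L] [Algebra K L]

/-- `A` and `B` are nonzero subspaces whose product is contained in `C`. -/
structure IsProductPair (C A B : Submodule K L) : Prop where
  left_ne_bot : A ≠ ⊥
  right_ne_bot : B ≠ ⊥
  mul_mem : ∀ a ∈ A, ∀ b ∈ B, a * b ∈ C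

namespace IsProductPair

variable {C A B : Submodule K L}

theorem exists_rightTranslate_le (h : IsProductPair C A B) :
    ∃ b ≠ (0 : L), rightTranslate b A ≤ C := by
  obtain ⟨b, hb, hb0⟩ := B.ne_bot_iff.1 h.right_ne_bot
  refine ⟨b, hb0, ?_⟩
  rintro _ ⟨a, ha, rfl⟩
  exact h.mul_mem a ha b hb

theorem exists_leftTranslate_le (h : IsProductPair C A B) :
    ∃ a ≠ (0 : L), leftTranslate a B ≤ C := by
  obtain ⟨a, ha, ha0⟩ := A.ne_bot_iff.1 h.left_ne_bot
  refine ⟨a, ha0, ?_⟩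
  rintro _ ⟨b, hb, rfl⟩
  exact h.mul_mem a ha b hb

/-- An element of `A ∩ Ag` can absorb `g⁻¹` on its right and stay in `A`, so the product with `g⁻¹B`
still lands in `C`. -/
theorem inf_sup (h : IsProductPair C A B) {g : L} (hg : g ≠ 0)
    (hne : A ⊓ rightTranslate g A ≠ ⊥) :
    IsProductPair C (A ⊓ rightTranslate g A) (B ⊔ leftTranslate g⁻¹ B) := by
  refine ⟨hne, fun hb => h.right_ne_bot (eq_bot_iff.2 (hb ▸ le_sup_left)), ?_⟩
  rintro a ⟨ha, ha'⟩ b hb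
  rw [SetLike.mem_coe, mem_rightTranslate hg] at ha'
  obtain ⟨x, hx, _, ⟨y, hy, rfl⟩, rfl⟩ := Submodule.mem_sup.1 hb
  rw [mul_add, LinearMap.mulLeft_apply, ← mul_assoc]
  exact C.add_mem (h.mul_mem a ha x hx) (h.mul_mem _ ha' y hy)

theorem sup_inf (h : IsProductPair C A B) {g : L} (hg : g ≠ 0)
    (hne : B ⊓ leftTranslate g⁻¹ B ≠ ⊥) :
    IsProductPair C (A ⊔ rightTranslate g A) (B ⊓ leftTranslate g⁻¹ B) := by
  refine ⟨fun hb => h.left_ne_bot (eq_bot_iff.2 (hb ▸ le_sup_left)), hne, ?_⟩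
  rintro a ha b ⟨hb, hb'⟩
  rw [SetLike.mem_coe, mem_leftTranslate (inv_ne_zero hg), inv_inv] at hb'
  obtain ⟨x, hx, _, ⟨y, hy, rfl⟩, rfl⟩ := Submodule.mem_sup.1 ha
  rw [add_mul, LinearMap.mulRight_apply, mul_assoc]
  exact C.add_mem (h.mul_mem x hx b hb) (h.mul_mem y hy _ hb')

variable [FiniteDimensional K C]

theorem finiteDimensional_left (h : IsProductPair C A B) : FiniteDimensional K A := by
  obtain ⟨b, hb, hle⟩ := h.exists_rightTranslate_le
  have := Submodule.finiteDimensional_of_le hle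
  exact (rightTranslateEquiv hb A).symm.finiteDimensional

theorem finiteDimensional_right (h : IsProductPair C A B) : FiniteDimensional K B := by
  obtain ⟨a, ha, hle⟩ := h.exists_leftTranslate_le
  have := Submodule.finiteDimensional_of_le hle
  exact (leftTranslateEquiv ha B).symm.finiteDimensional

theorem finrank_left_le (h : IsProductPair C A B) : finrank K A ≤ finrank K C := by
  obtain ⟨b, hb, hle⟩ := h.exists_rightTranslate_le
  rw [(rightTranslateEquiv hb A).finrank_eq]
  exact Submodule.finrank_mono hle

theorem finrank_right_le (h : IsProductPair C A B) : finrank K B ≤ finrank K C := by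
  obtain ⟨a, ha, hle⟩ := h.exists_leftTranslate_le
  rw [(leftTranslateEquiv ha B).finrank_eq]
  exact Submodule.finrank_mono hle

theorem finrank_transform (h : IsProductPair C A B) {g : L} (hg : g ≠ 0) :
    finrank K (A ⊔ rightTranslate g A : Submodule K L) +
        finrank K (A ⊓ rightTranslate g A : Submodule K L) = 2 * finrank K A ∧
      finrank K (B ⊔ leftTranslate g⁻¹ B : Submodule K L) +
        finrank K (B ⊓ leftTranslate g⁻¹ B : Submodule K L) = 2 * finrank K B := by
  have := h.finiteDimensional_left
  have := h.finiteDimensional_right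
  rw [Submodule.finrank_sup_add_finrank_inf_eq, Submodule.finrank_sup_add_finrank_inf_eq,
    ← (rightTranslateEquiv hg A).finrank_eq, ← (leftTranslateEquiv (inv_ne_zero hg) B).finrank_eq]
  omega

/-- A product pair of maximal total dimension whose smaller member is as small as possible. -/
theorem exists_extremal (h : IsProductPair C A B) :
    ∃ A₀ B₀ : Submodule K L, IsProductPair C A₀ B₀ ∧
      (∀ A' B', IsProductPair C A' B' →
        finrank K A' + finrank K B' ≤ finrank K A₀ + finrank K B₀) ∧
      ∀ A' B', IsProductPair C A' B' →
        finrank K A₀ + finrank K B₀ ≤ finrank K A' + finrank K B' →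
        min (finrank K A₀) (finrank K B₀) ≤ min (finrank K A') (finrank K B') := by
  let s : Submodule K L × Submodule K L → ℕ := fun p => finrank K p.1 + finrank K p.2
  -- Both factors have dimension at most that of `C`, so the truncated subtraction loses nothing and
  -- minimizing it maximizes `s`.
  obtain ⟨p, hp, hpmax⟩ := (measure fun p => 2 * finrank K C - s p).wf.has_min
    {p | IsProductPair C p.1 p.2} ⟨(A, B), h⟩
  obtain ⟨q, ⟨hq, hsq⟩, hqmin⟩ :=
    (measure fun p : Submodule K L × Submodule K L => min (finrank K p.1) (finrank K p.2)).wf.has_min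
    {q | IsProductPair C q.1 q.2 ∧ s p ≤ s q} ⟨p, hp, le_rfl⟩
  refine ⟨q.1, q.2, hq, fun A' B' h' => ?_, fun A' B' h' hle => ?_⟩
  · have h1 : ¬ 2 * finrank K C - s (A', B') < 2 * finrank K C - s p := hpmax (A', B') h'
    have h2 := h'.finrank_left_le
    have h3 := h'.finrank_right_le
    have h4 := hp.finrank_left_le
    have h5 := hp.finrank_right_le
    simp only [s] at h1 hsq
    omega
  · exact not_lt.1 (hqmin (A', B') ⟨h', hsq.trans hle⟩)

/-- The linear analogue of a theorem of Kemperman: if `A B ⊆ C` and `C` is too small, then `C`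
contains a translate of a nontrivial sub-division ring. -/
theorem containsNontrivialTranslate (h : IsProductPair C A B)
    (hdim : finrank K C + 2 ≤ finrank K A + finrank K B) : ContainsNontrivialTranslate C := by
  obtain ⟨A₀, B₀, h₀, hmax, hmin⟩ := h.exists_extremal
  replace hdim := hdim.trans (hmax A B h)
  clear h
  have := h₀.finiteDimensional_left
  have := h₀.finiteDimensional_right
  have hAC := h₀.finrank_left_le
  have hBC := h₀.finrank_right_le
  -- The two transforms have total dimensions averaging to the maximum, so both attain it.
  have key : ∀ g : L, g ≠ 0 → A₀ ⊓ rightTranslate g A₀ ≠ ⊥ → B₀ ⊓ leftTranslate g⁻¹ B₀ ≠ ⊥ →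
      finrank K A₀ + finrank K B₀ ≤ finrank K (A₀ ⊓ rightTranslate g A₀ : Submodule K L) +
        finrank K (B₀ ⊔ leftTranslate g⁻¹ B₀ : Submodule K L) ∧
      finrank K A₀ + finrank K B₀ ≤ finrank K (A₀ ⊔ rightTranslate g A₀ : Submodule K L) +
        finrank K (B₀ ⊓ leftTranslate g⁻¹ B₀ : Submodule K L) := by
    intro g hg hA hB
    have h1 := hmax _ _ (h₀.inf_sup hg hA)
    have h2 := hmax _ _ (h₀.sup_inf hg hB)
    have h3 := h₀.finrank_transform hg
    omega
  rcases le_total (finrank K A₀) (finrank K B₀) with hle | hle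
  · have hstab : ∀ g : L, g ≠ 0 → ∀ x ∈ A₀, x ≠ 0 → x * g ∈ A₀ → ∀ y ∈ A₀, y * g⁻¹ ∈ A₀ := by
      intro g hg x hx hx0 hxg y hy
      have hne : A₀ ⊓ rightTranslate g A₀ ≠ ⊥ := (Submodule.ne_bot_iff _).2
        ⟨x * g, ⟨hxg, (mem_rightTranslate hg).2 (by simpa [hg] using hx)⟩, mul_ne_zero hx0 hg⟩
      have hsum : finrank K A₀ + finrank K B₀ ≤
          finrank K (A₀ ⊓ rightTranslate g A₀ : Submodule K L) +
          finrank K (B₀ ⊔ leftTranslate g⁻¹ B₀ : Submodule K L) := by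
        -- If the second transform degenerates, the sum `B₀ + g⁻¹B₀` is direct, of dimension 2 dim
        -- `B₀` ≥ dim `A₀` + dim `B₀`.
        by_cases hB : B₀ ⊓ leftTranslate g⁻¹ B₀ = ⊥
        · have h3 := (h₀.finrank_transform hg).2
          rw [hB, finrank_bot] at h3
          omega
        · exact (key g hg hne hB).1
      have hm := hmin _ _ (h₀.inf_sup hg hne) hsum
      have heq := Submodule.eq_of_le_of_finrank_le
        (inf_le_left : A₀ ⊓ rightTranslate g A₀ ≤ A₀) (by omega)
      exact (mem_rightTranslate hg).1 (inf_eq_left.1 heq hy)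
    obtain ⟨b, hb, hbC⟩ := h₀.exists_rightTranslate_le
    have hrank := (rightTranslateEquiv hb A₀).finrank_eq
    obtain ⟨M, hM, l, hl, hlM⟩ := exists_leftTranslate_eq_of_mul_inv_mem
      (A := rightTranslate b A₀)
      (by
        intro hbot
        rw [hbot, finrank_bot] at hrank
        omega)
      (by
        intro g hg x hx hx0 hxg y hy
        rw [mem_rightTranslate hb] at hx hxg hy ⊢
        -- Right multiplication by `g` on `A₀b` corresponds to right multiplication by `bgb⁻¹` on
        -- `A₀`.
        have := hstab (b * g * b⁻¹) (by simp [hb, hg]) _ hx (by simp [hb, hx0])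
          (by simpa [mul_assoc, hb] using hxg) _ hy
        simpa [mul_assoc, hb] using this)
    have e := leftTranslateEquiv hl (Subalgebra.toSubmodule M)
    rw [hlM] at e
    refine ⟨M, hM, e.symm.finiteDimensional, ?_, l, hl, Or.inl (hlM.trans_le hbC)⟩
    -- The larger factor has dimension at most dim `C`, so the smaller one has dimension at least 2.
    rintro rfl
    have h1 := e.finrank_eq
    have h2 : finrank K (Subalgebra.toSubmodule (⊥ : Subalgebra K L)) = 1 :=
      Subalgebra.finrank_bot
    omega
  · have hstab : ∀ g : L, g ≠ 0 → ∀ x ∈ B₀, x ≠ 0 → g * x ∈ B₀ → ∀ y ∈ B₀, g⁻¹ * y ∈ B₀ := by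
      intro g hg x hx hx0 hxg y hy
      have hg' := inv_ne_zero hg
      have hne : B₀ ⊓ leftTranslate g⁻¹⁻¹ B₀ ≠ ⊥ := (Submodule.ne_bot_iff _).2
        ⟨g * x, ⟨hxg, by simpa [mem_leftTranslate, hg] using hx⟩, mul_ne_zero hg hx0⟩
      have hsum : finrank K A₀ + finrank K B₀ ≤
          finrank K (A₀ ⊔ rightTranslate g⁻¹ A₀ : Submodule K L) +
          finrank K (B₀ ⊓ leftTranslate g⁻¹⁻¹ B₀ : Submodule K L) := by
        by_cases hA : A₀ ⊓ rightTranslate g⁻¹ A₀ = ⊥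
        · have h3 := (h₀.finrank_transform hg').1
          rw [hA, finrank_bot] at h3
          omega
        · exact (key g⁻¹ hg' hA hne).2
      have hm := hmin _ _ (h₀.sup_inf hg' hne) hsum
      have heq := Submodule.eq_of_le_of_finrank_le
        (inf_le_left : B₀ ⊓ leftTranslate g⁻¹⁻¹ B₀ ≤ B₀) (by omega)
      simpa [mem_leftTranslate, hg] using inf_eq_left.1 heq hy
    obtain ⟨a, ha, haC⟩ := h₀.exists_leftTranslate_le
    have hrank := (leftTranslateEquiv ha B₀).finrank_eq
    obtain ⟨M, hM, l, hl, hlM⟩ := exists_rightTranslate_eq_of_inv_mul_mem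
      (A := leftTranslate a B₀)
      (by
        intro hbot
        rw [hbot, finrank_bot] at hrank
        omega)
      (by
        intro g hg x hx hx0 hxg y hy
        rw [mem_leftTranslate ha] at hx hxg hy ⊢
        have := hstab (a⁻¹ * g * a) (by simp [ha, hg]) _ hx (by simp [ha, hx0])
          (by simpa [mul_assoc, ha] using hxg) _ hy
        simpa [mul_assoc, ha] using this)
    have e := rightTranslateEquiv hl (Subalgebra.toSubmodule M)
    rw [hlM] at e
    refine ⟨M, hM, e.symm.finiteDimensional, ?_, l, hl, Or.inr (hlM.trans_le haC)⟩
    rintro rfl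
    have h1 := e.finrank_eq
    have h2 : finrank K (Subalgebra.toSubmodule (⊥ : Subalgebra K L)) = 1 :=
      Subalgebra.finrank_bot
    omega

end IsProductPair

end Product

/-! ### The matching theorem -/

theorem theorem3p3 {K L : Type*} [Field K] [DivisionRing L] [Algebra K L]
    (n : ℕ) (hn : 1 ≤ n) (A : Submodule K L) (hA : Module.finrank K A = n)
    (hAM : ¬ ContainsNontrivialTranslate A)
    (B : Submodule K L) (hB : Module.finrank K B = n) (h1 : (1 : L) ∉ B) :
    SubspaceMatched n A B := by
  intro a
  have : FiniteDimensional K A := FiniteDimensional.of_finrank_pos (by omega)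
  have : FiniteDimensional K B := FiniteDimensional.of_finrank_pos (by omega)
  let U : Fin n → Submodule K B := fun i => (leftTranslate ((a i : L)⁻¹) A).comap B.subtype
  have ha0 : ∀ i, (a i : L) ≠ 0 := fun i => by simpa using a.ne_zero i
  have hU : ∀ i x, x ∈ U i ↔ (a i : L) * x ∈ A := fun i x => by
    simp [U, mem_leftTranslate (inv_ne_zero (ha0 i))]
  obtain ⟨b, hb⟩ := exists_basis_le_span_of_finrank_inf_add_card_le (by simp [hB]) U (by
    intro J
    rw [hB]
    rcases J.eq_empty_or_nonempty with rfl | ⟨i₀, hi₀⟩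
    · simpa [hB] using Submodule.finrank_le ((∅ : Finset (Fin n)).inf U)
    by_contra hlt
    let W : Submodule K L := (J.inf U).map B.subtype
    let S : Submodule K L := Submodule.span K ((fun i => (a i : L)) '' J)
    have hW : finrank K W = finrank K (J.inf U : Submodule K B) :=
      (Submodule.equivMapOfInjective _ B.injective_subtype _).finrank_eq.symm
    have hS : finrank K S = J.card := by
      have hli : LinearIndependent K (fun i : J => (a i : L)) :=
        (a.linearIndependent.map' A.subtype A.ker_subtype).comp _ Subtype.val_injective
      have himage : (fun i => (a i : L)) '' J = Set.range fun i : J => (a i : L) := by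
        ext x
        simp
      rw [← Fintype.card_coe, ← finrank_span_eq_card hli, ← himage]
    have hW1 : (1 : L) ∉ W := by
      rintro ⟨x, -, hx⟩
      exact h1 (hx ▸ x.2)
    have hW' : finrank K (W ⊔ K ∙ (1 : L) : Submodule K L) = finrank K W + 1 := by
      have hdisj : W ⊓ K ∙ (1 : L) = ⊥ :=
        ((Submodule.disjoint_span_singleton' one_ne_zero).2 hW1).eq_bot
      have := Submodule.finrank_sup_add_finrank_inf_eq W (K ∙ (1 : L))
      rwa [hdisj, finrank_bot, finrank_span_singleton one_ne_zero] at this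
    have hSA : S ≤ A := Submodule.span_le.2 (by
      rintro _ ⟨i, -, rfl⟩
      exact (a i).2)
    have hpair : IsProductPair A S (W ⊔ K ∙ (1 : L)) := by
      refine ⟨?_, ?_, ?_⟩
      · exact (Submodule.ne_bot_iff _).2
          ⟨a i₀, Submodule.subset_span ⟨i₀, hi₀, rfl⟩, ha0 i₀⟩
      · exact (Submodule.ne_bot_iff _).2
          ⟨1, Submodule.mem_sup_right (Submodule.mem_span_singleton_self 1), one_ne_zero⟩
      · intro s hs w hw
        obtain ⟨_, ⟨x, hx, rfl⟩, y, hy, rfl⟩ := Submodule.mem_sup.1 hw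
        obtain ⟨c, rfl⟩ := Submodule.mem_span_singleton.1 hy
        rw [mul_add, mul_smul_comm, mul_one]
        refine A.add_mem ?_ (A.smul_mem c (hSA hs))
        have hle : S ≤ A.comap (LinearMap.mulRight K (x : L)) := Submodule.span_le.2 (by
          rintro _ ⟨i, hi, rfl⟩
          exact (hU i x).1 (Finset.inf_le (f := U) hi hx))
        exact hle hs
    -- |J| + dim `W` ≥ n + 1 by `hlt`, and adjoining 1 adds one more.
    exact hAM (hpair.containsNontrivialTranslate (by omega)))
  refine ⟨b, fun i x hx => ?_⟩
  have hmem := hb i (show (⟨x, hx.2⟩ : B) ∈ U i from hx.1)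
  have := Submodule.mem_map_of_mem (f := B.subtype) hmem
  rwa [Submodule.map_span, Set.image_image] at this
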